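/- Let $\mathcal F_n$ be the set of $3$-regular graphs (loops and multiple edges allowed) on $2n$ vertices, and let $\mathcal F_n^*$ be the set of such graphs with an orientation, i.e. a cyclic ordering of the three half-edges at every vertex. Give both sets the following probability measure: a hat contains $6n$ balls, three of them labeled by each of the $2n$ vertices; balls are drawn from it at random in pairs, without replacement, until it is empty; if the $i$-th pair is labeled $b_i, c_i$, an edge joining $b_i$ and $c_i$ is added to the graph; the orientation at a vertex is the cyclic order in which the half-edges are attached to it (for a loop, in the order of the two balls of the pair). A closed path of length $l\ge 1$ is a cyclic sequence of $l$ directed edges, each starting at the vertex where the preceding one ends, which never (cyclically) traverses an edge and then immediately the same edge in the opposite direction. Vertices and edges may be repeated; the path is a simple cycle if it repeats no vertex. Two closed paths are distance $d$ apart if $d$ is the least graph distance between a vertex of one and a vertex of the other. For fixed integers $l_1, l_2 \ge 1$ and $d\ge 0$, let $Q_n(l_1,l_2,d)$ denote the probability that a graph picked from $\mathcal F_n$ (resp. $\mathcal F_n^*$) has closed paths $\gamma_1$ and $\gamma_2$, of length $l_1$ and $l_2$ respectively, which are distance $d$ apart and do not both run around one and the same simple cycle (this last condition matters only for $d=0$).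 Then, in both cases, $$Q_n(l_1,l_2,d)\to 0 \quad\text{as } n\to\infty .$$ -/

import Mathlib

open Filter Topology

/-- A `3`-regular graph with vertex type `V` and edge type `E`; loops and multiple edges are
allowed. Each edge `e` has two half-edges `(e, false)` and `(e, true)`, and `tail` gives the vertex
to which a half-edge is attached. Every vertex carries exactly three half-edges. -/
structure CubicGraph (V E : Type) where
  tail : E × Bool → V
  cubic : ∀ v : V, Nat.card {x : E × Bool // tail x = v} = 3

namespace CubicGraph

variable {V E : Type}

/-- The other half-edge of the same edge. A half-edge `x` is also read as its edge, directed so as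
to leave `tail x`; then `rev x` is the same edge in the opposite direction. -/
def rev (x : E × Bool) : E × Bool := (x.1, !x.2)

/-- The vertex at which the directed edge `x` arrives. -/
def head (Γ : CubicGraph V E) (x : E × Bool) : V := Γ.tail (rev x)

/-- An orientation: a cyclic ordering of the three half-edges at each vertex, given by the
permutation that sends each half-edge to its successor at the same vertex. -/
structure Orientation (Γ : CubicGraph V E) where
  next : Equiv.Perm (E × Bool)
  tail_next : ∀ x, Γ.tail (next x) = Γ.tail x
  sameCycle : ∀ x y, Γ.tail x = Γ.tail y → next.SameCycle x y

/-- A closed path of length `l`: a cyclic sequence of `l` directed edges, each starting where its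
predecessor ends, which never turns back along the edge it has just traversed (cyclically: also not
at the starting point). -/
structure ClosedPath (Γ : CubicGraph V E) (l : ℕ) where
  edge : Fin l → E × Bool
  adj : ∀ j, Γ.tail (edge (finRotate l j)) = Γ.head (edge j)
  reduced : ∀ j, edge (finRotate l j) ≠ rev (edge j)

namespace ClosedPath

variable {Γ : CubicGraph V E} {l l₁ l₂ : ℕ}

/-- The set of vertices on a closed path. -/
def verts (γ : Γ.ClosedPath l) : Set V := Set.range fun j => Γ.tail (γ.edge j)

/-- The set of (undirected) edges on a closed path. -/
def edges (γ : Γ.ClosedPath l) : Set E := Set.range fun j => (γ.edge j).1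

/-- A closed path is simple if it meets no vertex twice. -/
def IsSimple (γ : Γ.ClosedPath l) : Prop := Function.Injective fun j => Γ.tail (γ.edge j)

/-- Both closed paths run (possibly several times, from any starting point, in either direction)
around one and the same simple cycle. -/
def SameSimpleCycle (γ₁ : Γ.ClosedPath l₁) (γ₂ : Γ.ClosedPath l₂) : Prop :=
  ∃ (k : ℕ) (c : Γ.ClosedPath k), c.IsSimple ∧ γ₁.edges = c.edges ∧ γ₂.edges = c.edges

end ClosedPath

/-- The simple graph recording which pairs of distinct vertices are joined by an edge. It has the
same distances as `Γ`. -/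
def toSimpleGraph (Γ : CubicGraph V E) : SimpleGraph V :=
  SimpleGraph.fromRel fun u v => ∃ x, Γ.tail x = u ∧ Γ.head x = v

/-- The distance of two sets of vertices: the smallest number of edges on a path from one to the
other (`⊤` if there is no such path). -/
noncomputable def setDist (Γ : CubicGraph V E) (A B : Set V) : ℕ∞ :=
  ⨅ u ∈ A, ⨅ v ∈ B, Γ.toSimpleGraph.edist u v

/-- `Γ` has closed paths of lengths `l₁` and `l₂` at distance `d` from each other, which are really
two: they do not both run around the same simple cycle. For `d ≥ 1` the last clause is automatic. -/
def HasClosedPathsAtDist (Γ : CubicGraph V E) (l₁ l₂ d : ℕ) : Prop :=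
  ∃ (γ₁ : Γ.ClosedPath l₁) (γ₂ : Γ.ClosedPath l₂),
    ¬ γ₁.SameSimpleCycle γ₂ ∧ Γ.setDist γ₁.verts γ₂.verts = d

end CubicGraph

/-- `3`-regular graphs on `2n` vertices, with their `3n` edges numbered. -/
abbrev CubicOn (n : ℕ) : Type := CubicGraph (Fin (2 * n)) (Fin (3 * n))

/-- `3`-regular graphs on `2n` vertices with an orientation. -/
abbrev OrientedCubicOn (n : ℕ) : Type := Σ Γ : CubicOn n, Γ.Orientation

/-- The ways to empty, in `3n` steps and without replacement, a hat with `6n` balls, three of them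
labeled with each of the `2n` vertices. The ball `(v, k)` is labeled `v`; step `i` draws the balls
`σ (i, false)` and `σ (i, true)`, in this order. -/
abbrev Drawing (n : ℕ) : Type := (Fin (3 * n) × Bool) ≃ (Fin (2 * n) × Fin 3)

instance (n : ℕ) : Nonempty (Drawing n) := by
  refine ⟨Fintype.equivOfCardEq ?_⟩
  simp
  ring

namespace Drawing

variable {n : ℕ}

/-- The graph built from a drawing: step `i` adds an edge joining the labels of the two balls. -/
def graph (σ : Drawing n) : CubicOn n where
  tail x := (σ x).1
  cubic v := by
    have e : {x : Fin (3 * n) × Bool // (σ x).1 = v} ≃ Fin 3 :=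
      { toFun := fun x => (σ x.1).2
        invFun := fun k => ⟨σ.symm (v, k), by simp⟩
        left_inv := by
          rintro ⟨x, rfl⟩
          simp
        right_inv := fun k => by simp }
    simpa using Nat.card_congr e

/-- The half-edges attached to the same vertex as `x` before `x` was. Half-edges are ordered by
the step that drew them and, in the same step (a loop), by the order of the two balls. -/
def earlier (σ : Drawing n) (x : Fin (3 * n) × Bool) : Finset (Fin (3 * n) × Bool) :=
  {y | (σ y).1 = (σ x).1 ∧ toLex y < toLex x}

theorem earlier_card_lt (σ : Drawing n) (x : Fin (3 * n) × Bool) : (σ.earlier x).card < 3 := by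
  have h3 : (Finset.univ.filter fun y => (σ y).1 = (σ x).1).card = 3 := by
    rw [← Fintype.card_subtype, ← Nat.card_eq_fintype_card]
    exact σ.graph.cubic (σ x).1
  refine lt_of_lt_of_eq (Finset.card_lt_card ?_) h3
  refine (Finset.ssubset_iff_of_subset ?_).2 ⟨x, by simp, by simp [earlier]⟩
  intro y hy
  simp only [earlier, Finset.mem_filter] at hy ⊢
  exact ⟨hy.1, hy.2.1⟩

theorem earlier_card_lt_card (σ : Drawing n) {x y : Fin (3 * n) × Bool}
    (h : (σ x).1 = (σ y).1) (hlt : toLex x < toLex y) :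
    (σ.earlier x).card < (σ.earlier y).card := by
  apply Finset.card_lt_card
  refine (Finset.ssubset_iff_of_subset ?_).2 ⟨x, by simp [earlier, h, hlt], by simp [earlier]⟩
  intro z hz
  simp only [earlier, Finset.mem_filter, Finset.mem_univ, true_and] at hz ⊢
  exact ⟨hz.1.trans h, hz.2.trans hlt⟩

/-- A half-edge is sent to its vertex and its rank (`0`, `1` or `2`) in the order in which the
half-edges were attached to this vertex. -/
def rank (σ : Drawing n) (x : Fin (3 * n) × Bool) : Fin (2 * n) × Fin 3 :=
  ((σ x).1, ⟨(σ.earlier x).card, σ.earlier_card_lt x⟩)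

theorem rank_bijective (σ : Drawing n) : Function.Bijective σ.rank := by
  rw [Fintype.bijective_iff_injective_and_card]
  refine ⟨fun x y h => ?_, Fintype.card_congr σ⟩
  simp only [rank, Prod.mk.injEq, Fin.mk.injEq] at h
  by_contra hne
  rcases lt_or_gt_of_ne (fun hh => hne (toLex.injective hh)) with hl | hl
  · exact absurd h.2 (σ.earlier_card_lt_card h.1 hl).ne
  · exact absurd h.2 (σ.earlier_card_lt_card h.1.symm hl).ne'

/-- The half-edge at the same vertex whose rank is next, cyclically. -/
noncomputable def next (σ : Drawing n) : Equiv.Perm (Fin (3 * n) × Bool) :=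
  let e := Equiv.ofBijective σ.rank σ.rank_bijective
  (e.trans (Equiv.prodCongr (Equiv.refl _) (finRotate 3))).trans e.symm

theorem rank_next (σ : Drawing n) (x : Fin (3 * n) × Bool) :
    σ.rank (σ.next x) = ((σ.rank x).1, (σ.rank x).2 + 1) := by
  have h := (Equiv.ofBijective σ.rank σ.rank_bijective).apply_symm_apply
    ((σ.rank x).1, finRotate 3 (σ.rank x).2)
  rw [← finRotate_apply]
  exact h

/-- The orientation built from a drawing: the half-edges at each vertex are ordered cyclically as
they were attached to it. -/
noncomputable def orientation (σ : Drawing n) : σ.graph.Orientation where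
  next := σ.next
  tail_next x := congrArg (fun p => p.1) (σ.rank_next x)
  sameCycle x y h := by
    have h1 : (σ.rank x).1 = (σ.rank y).1 := h
    have key : ∀ a b : Fin 3, b = a ∨ b = a + 1 ∨ b = a + 1 + 1 := by decide
    rcases key (σ.rank x).2 (σ.rank y).2 with hk | hk | hk
    · exact ⟨0, σ.rank_bijective.1 (Prod.ext h1 hk.symm)⟩
    · refine ⟨1, σ.rank_bijective.1 ?_⟩
      rw [zpow_one, rank_next]
      exact Prod.ext h1 hk.symm
    · refine ⟨2, σ.rank_bijective.1 ?_⟩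
      rw [zpow_two, Equiv.Perm.mul_apply, rank_next, rank_next]
      exact Prod.ext h1 hk.symm

end Drawing

/-- The probability measure on `3`-regular graphs on `2n` vertices: all drawings are equally
likely. -/
noncomputable def cubicPMF (n : ℕ) : PMF (CubicOn n) :=
  (PMF.uniformOfFintype (Drawing n)).map Drawing.graph

/-- The probability measure on `3`-regular graphs on `2n` vertices with orientation. -/
noncomputable def orientedCubicPMF (n : ℕ) : PMF (OrientedCubicOn n) :=
  (PMF.uniformOfFintype (Drawing n)).map fun σ => ⟨σ.graph, σ.orientation⟩

/-- The probability of an event for a discrete probability distribution. -/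
noncomputable def PMF.prob {α : Type} (p : PMF α) (A : Set α) : ENNReal := p.toOuterMeasure A

/-!
The proof is a first moment argument resting on one fact about graphs: two closed paths of lengths
`l₁`, `l₂` at distance `d`, not both running around one simple cycle, span together with a path
that joins them an edge set `S` of at most `l₁ + l₂ + d` edges with fewer vertices than edges
(`CubicGraph.HasClosedPathsAtDist.exists_card_lt`). To see this, note that all degrees in `S` are
at least two, since closed paths do not turn back and the inner vertices of the connecting path
have two different neighbours on it. If `S` had at most as many edges as vertices, all degrees would
be equal to two. Then a closed path in `S` contains every edge of `S` that meets it, so the first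
path absorbs the connecting path and then has the same edges as the second path, and also
the same edges as a simple closed path inside it, contrary to the assumption. The argument
is uniform in `d`; there is no need to treat `d = 0` separately.

An edge set with fewer vertices than edges contains `k + 1` edges with all their ends among `k`
vertices, for some `k < l₁ + l₂ + d`. There are at most `(3n) ^ (k + 1) * (2n) ^ k` choices
of these edges and vertices, and each choice occurs with probability at most
`(3k) ^ (2k + 2) / (6n (6n - 1) ⋯ (6n - 2k - 1))`, because `2k + 2` balls are to be drawn among
given `3k` ones. The product is `O(1 / n)` (`Drawing.card_dense_mul_le`), and a union bound over
`k` finishes the proof.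
-/

/-! ### Closed paths -/

namespace CubicGraph

variable {V E : Type}

@[simp] theorem rev_rev (x : E × Bool) : rev (rev x) = x := by simp [rev]

theorem rev_ne (x : E × Bool) : rev x ≠ x := by
  obtain ⟨e, b⟩ := x
  simp [rev]

theorem eq_or_eq_rev {x y : E × Bool} (h : x.1 = y.1) : x = y ∨ x = rev y := by
  obtain ⟨e, b⟩ := x
  obtain ⟨e', b'⟩ := y
  obtain rfl : e = e' := h
  cases b <;> cases b' <;> simp [rev]

namespace ClosedPath

variable {Γ : CubicGraph V E} {l l' : ℕ}

theorem tail_mem_verts (γ : Γ.ClosedPath l) (j : Fin l) : Γ.tail (γ.edge j) ∈ γ.verts :=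
  ⟨j, rfl⟩

theorem head_mem_verts (γ : Γ.ClosedPath l) (j : Fin l) : Γ.head (γ.edge j) ∈ γ.verts :=
  ⟨finRotate l j, γ.adj j⟩

theorem tail_mem_verts_of_mem_edges (γ : Γ.ClosedPath l) {x : E × Bool} (hx : x.1 ∈ γ.edges) :
    Γ.tail x ∈ γ.verts := by
  obtain ⟨j, hj⟩ := hx
  rcases eq_or_eq_rev hj with h | h
  · exact h ▸ γ.tail_mem_verts j
  · have : x = rev (γ.edge j) := by rw [h, rev_rev]
    rw [this]
    exact γ.head_mem_verts j

/-- A closed path leaves each of its vertices by another half-edge than the one by which it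
arrives. -/
theorem exists_ne_of_mem_verts (γ : Γ.ClosedPath l) {v : V} (hv : v ∈ γ.verts) :
    ∃ x y : E × Bool, x ≠ y ∧ (Γ.tail x = v ∧ x.1 ∈ γ.edges) ∧ (Γ.tail y = v ∧ y.1 ∈ γ.edges) := by
  obtain ⟨j, rfl⟩ := hv
  obtain ⟨i, rfl⟩ := (finRotate l).surjective j
  exact ⟨_, _, γ.reduced i, ⟨rfl, _, rfl⟩, (γ.adj i).symm, i, rfl⟩

/-- A property of half-edges that passes from each edge of a closed path to the following one holds
along the whole path as soon as it holds somewhere on it. -/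
theorem forall_of_rotate (γ : Γ.ClosedPath l) (P : E × Bool → Prop)
    (hP : ∀ j, P (γ.edge j) → P (γ.edge (finRotate l j))) {i : Fin l} (hi : P (γ.edge i))
    (j : Fin l) : P (γ.edge j) := by
  obtain _ | l := l
  · exact i.elim0
  have key : ∀ m : ℕ, P (γ.edge (i + Fin.ofNat (l + 1) m)) := by
    intro m
    induction m with
    | zero => simpa using hi
    | succ m ih =>
      have := hP _ ih
      rw [finRotate_apply, add_assoc] at this
      convert this using 4
      ext
      simp [Fin.val_add]
  have hj : Fin.ofNat (l + 1) (j - i).val = j - i := Fin.ext (Nat.mod_eq_of_lt (j - i).2)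
  have := key (j - i).val
  rwa [hj, add_sub_cancel] at this

/-- The subpath of a closed path between two visits of the same vertex, as close together as
possible, is a simple closed path: if it turned back at its endpoint, then two closer visits would
be found at its second and its last but one vertex. -/
theorem exists_isSimple (γ : Γ.ClosedPath l) (hl : 0 < l) :
    ∃ (k : ℕ) (c : Γ.ClosedPath k), 0 < k ∧ c.IsSimple ∧ c.edges ⊆ γ.edges := by
  classical
  obtain ⟨l, rfl⟩ : ∃ m, l = m + 1 := ⟨l - 1, by omega⟩
  -- the path, continued periodically
  let f : ℕ → E × Bool := fun i => γ.edge (Fin.ofNat (l + 1) i)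
  have hs : ∀ i, finRotate (l + 1) (Fin.ofNat (l + 1) i) = Fin.ofNat (l + 1) (i + 1) := by
    intro i
    rw [finRotate_apply]
    ext
    simp [Fin.val_add]
  have hadj : ∀ i, Γ.tail (f (i + 1)) = Γ.head (f i) := by
    intro i
    have := γ.adj (Fin.ofNat (l + 1) i)
    rwa [hs] at this
  have hred : ∀ i, f (i + 1) ≠ rev (f i) := by
    intro i
    have := γ.reduced (Fin.ofNat (l + 1) i)
    rwa [hs] at this
  have hex : ∃ k, 0 < k ∧ ∃ i, Γ.tail (f (i + k)) = Γ.tail (f i) :=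
    ⟨l + 1, by omega, 0, by simp [f]⟩
  obtain ⟨hk, i, hi⟩ := Nat.find_spec hex
  have hmin : ∀ k' < Nat.find hex, 0 < k' → ∀ i, Γ.tail (f (i + k')) ≠ Γ.tail (f i) := by
    intro k' hk' h0 i h
    exact Nat.find_min hex hk' ⟨h0, i, h⟩
  generalize Nat.find hex = k at hk hi hmin
  obtain ⟨k, rfl⟩ : ∃ m, k = m + 1 := ⟨k - 1, by omega⟩
  have hturn : f i ≠ rev (f (i + k)) := by
    intro h
    rcases k with _ | _ | k
    · exact rev_ne _ h.symm
    · exact hred i (by rw [h, rev_rev])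
    · refine hmin (k + 1) (by omega) (by omega) (i + 1) ?_
      rw [hadj i, h, head, rev_rev]
      congr 2
      omega
  have hrot : ∀ j : Fin (k + 1), j.val < k ∧ (finRotate (k + 1) j).val = j.val + 1 ∨
      j.val = k ∧ (finRotate (k + 1) j).val = 0 := by
    intro j
    rcases lt_or_eq_of_le (Nat.lt_succ_iff.1 j.2) with h | h
    · exact Or.inl ⟨h, by rw [coe_finRotate_of_ne_last]; exact fun hh => by simp [hh] at h⟩
    · refine Or.inr ⟨h, ?_⟩
      obtain rfl : j = Fin.last k := Fin.ext h
      simp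
  refine ⟨k + 1, ⟨fun j => f (i + j.val), fun j => ?_, fun j => ?_⟩, by omega, ?_, ?_⟩
  · rcases hrot j with ⟨-, h⟩ | ⟨h, h'⟩
    · simp only [h]
      exact hadj _
    · simp only [h, h', add_zero]
      rw [← hi]
      exact hadj _
  · rcases hrot j with ⟨-, h⟩ | ⟨h, h'⟩
    · simp only [h]
      exact hred _
    · simp only [h, h', add_zero]
      exact hturn
  · have aux : ∀ a b : Fin (k + 1), a.val < b.val →
        Γ.tail (f (i + a.val)) ≠ Γ.tail (f (i + b.val)) := by
      intro a b hab h
      refine hmin (b.val - a.val) (by omega) (by omega) (i + a.val) ?_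
      rw [h]
      congr 2
      omega
    intro a b hab
    rcases lt_trichotomy a.val b.val with h | h | h
    · exact absurd hab (aux a b h)
    · exact Fin.ext h
    · exact absurd hab.symm (aux b a h)
  · rintro _ ⟨j, rfl⟩
    exact ⟨_, rfl⟩

/-- If no vertex carries more than two half-edges of the edge set `S`, then a closed path in `S`
uses all edges of `S` at its vertices. -/
theorem mem_edges_of_tail_mem_verts (γ : Γ.ClosedPath l) {S : Set E} (hγ : γ.edges ⊆ S)
    (hS : ∀ x y z : E × Bool, x.1 ∈ S → y.1 ∈ S → z.1 ∈ S → Γ.tail y = Γ.tail x →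
      Γ.tail z = Γ.tail x → x = y ∨ x = z ∨ y = z)
    {x : E × Bool} (hx : x.1 ∈ S) (hv : Γ.tail x ∈ γ.verts) : x.1 ∈ γ.edges := by
  obtain ⟨y, z, hyz, ⟨hy, hy'⟩, hz, hz'⟩ := γ.exists_ne_of_mem_verts hv
  rcases hS x y z hx (hγ hy') (hγ hz') hy hz with h | h | h
  · rwa [h]
  · rwa [h]
  · exact absurd h hyz

/-- Closed paths with a common vertex in an edge set in which all degrees are at most two: the
first one runs along edges of the second one only. -/
theorem edges_subset_edges (γ : Γ.ClosedPath l) (γ' : Γ.ClosedPath l') {S : Set E}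
    (hγ : γ.edges ⊆ S) (hγ' : γ'.edges ⊆ S)
    (hS : ∀ x y z : E × Bool, x.1 ∈ S → y.1 ∈ S → z.1 ∈ S → Γ.tail y = Γ.tail x →
      Γ.tail z = Γ.tail x → x = y ∨ x = z ∨ y = z)
    {v : V} (hv : v ∈ γ.verts) (hv' : v ∈ γ'.verts) : γ.edges ⊆ γ'.edges := by
  obtain ⟨i, rfl⟩ := hv
  rintro _ ⟨j, rfl⟩
  refine γ.forall_of_rotate (fun x => x.1 ∈ γ'.edges) (fun j hj => ?_)
    (γ'.mem_edges_of_tail_mem_verts hγ' hS (hγ ⟨i, rfl⟩) hv') j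
  refine γ'.mem_edges_of_tail_mem_verts hγ' hS (hγ ⟨_, rfl⟩) ?_
  rw [γ.adj]
  exact γ'.tail_mem_verts_of_mem_edges (x := rev (γ.edge j)) hj

end ClosedPath

/-! ### Edge sets with more edges than vertices -/

/-- If every vertex met by the edge set `S` has degree at least two in `S`, and `S` has at most as
many edges as vertices, then no vertex has degree three or more in `S`. -/
theorem eq_or_eq_or_eq_of_card_le [DecidableEq V] [DecidableEq E] (Γ : CubicGraph V E)
    (S : Finset E)
    (hdeg : ∀ v ∈ (S ×ˢ Finset.univ).image Γ.tail, ∃ x y : E × Bool, x ≠ y ∧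
      (Γ.tail x = v ∧ x.1 ∈ S) ∧ (Γ.tail y = v ∧ y.1 ∈ S))
    (hcard : S.card ≤ ((S ×ˢ Finset.univ).image Γ.tail).card)
    (x y z : E × Bool) (hx : x.1 ∈ S) (hy : y.1 ∈ S) (hz : z.1 ∈ S)
    (hyx : Γ.tail y = Γ.tail x) (hzx : Γ.tail z = Γ.tail x) : x = y ∨ x = z ∨ y = z := by
  by_contra! hne
  let H : Finset (E × Bool) := S ×ˢ Finset.univ
  have hsum : H.card = ∑ v ∈ H.image Γ.tail, {x ∈ H | Γ.tail x = v}.card :=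
    Finset.card_eq_sum_card_image _ _
  have hlt : ∑ v ∈ H.image Γ.tail, 2 < ∑ v ∈ H.image Γ.tail, {x ∈ H | Γ.tail x = v}.card := by
    refine Finset.sum_lt_sum (fun v hv => ?_) ⟨Γ.tail x, ?_, ?_⟩
    · obtain ⟨a, b, hab, ⟨ha, ha'⟩, hb, hb'⟩ := hdeg v hv
      exact Finset.one_lt_card.2 ⟨a, by simp [H, ha, ha'], b, by simp [H, hb, hb'], hab⟩
    · exact Finset.mem_image_of_mem _ (by simp [H, hx])
    · exact Finset.two_lt_card.2 ⟨x, by simp [H, hx], y, by simp [H, hy, hyx], z,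
        by simp [H, hz, hzx], hne.1, hne.2.1, hne.2.2⟩
  have hH : H.card = S.card * 2 := by simp [H]
  rw [← hsum, hH, Finset.sum_const, smul_eq_mul] at hlt
  have : S.card ≤ (H.image Γ.tail).card := hcard
  omega

/-- Two vertices at distance `d` are joined by a path of `m ≤ d` edges without repeated vertices,
given by its vertices `w 0, …, w m` and directed edges `h 0, …, h (m - 1)`; further values of `w`
and `h` are arbitrary. -/
theorem exists_path (Γ : CubicGraph V E) {u v : V} {d : ℕ} (h : Γ.toSimpleGraph.edist u v = d) :
    ∃ (m : ℕ) (w : ℕ → V) (h : ℕ → E × Bool), m ≤ d ∧ w 0 = u ∧ w m = v ∧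
      (∀ i ≤ m, ∀ j ≤ m, w i = w j → i = j) ∧
      ∀ i < m, Γ.tail (h i) = w i ∧ Γ.head (h i) = w (i + 1) := by
  classical
  obtain ⟨p, hp⟩ := SimpleGraph.exists_walk_of_edist_ne_top (G := Γ.toSimpleGraph) (u := u) (v := v)
    (by rw [h]; exact ENat.natCast_ne_top d)
  have hpd : p.length = d := by exact_mod_cast hp.trans h
  have hq : p.bypass.IsPath := p.bypass_isPath
  have hstep : ∀ i : ℕ, ∃ x : E × Bool, i < p.bypass.length →
      Γ.tail x = p.bypass.getVert i ∧ Γ.head x = p.bypass.getVert (i + 1) := by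
    intro i
    by_cases hi : i < p.bypass.length
    · have hadj := p.bypass.adj_getVert_succ hi
      rcases ((SimpleGraph.fromRel_adj _ _ _).1 hadj).2 with ⟨x, hx⟩ | ⟨x, hx⟩
      · exact ⟨x, fun _ => hx⟩
      · exact ⟨rev x, fun _ => ⟨hx.2, by rw [head, rev_rev]; exact hx.1⟩⟩
    · have hd : Nonempty (E × Bool) := by
        have := Γ.cubic u
        obtain ⟨x⟩ := (Nat.card_pos_iff.1 (by omega : 0 < Nat.card {x // Γ.tail x = u})).1
        exact ⟨x.1⟩
      exact ⟨hd.some, fun h => absurd h hi⟩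
  choose f hf using hstep
  refine ⟨p.bypass.length, p.bypass.getVert, f, ?_, by simp, by simp, ?_, hf⟩
  · exact p.length_bypass_le_length.trans hpd.le
  · exact fun i hi j hj hij => hq.getVert_injOn hi hj hij

/-- The closed paths and a shortest connection between them form a small edge set with more edges
than vertices. -/
theorem HasClosedPathsAtDist.exists_card_lt [DecidableEq V] {Γ : CubicGraph V E} {l₁ l₂ d : ℕ}
    (hl₁ : 0 < l₁) (hl₂ : 0 < l₂) (h : Γ.HasClosedPathsAtDist l₁ l₂ d) :
    ∃ S : Finset E, S.card ≤ l₁ + l₂ + d ∧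
      ((S ×ˢ Finset.univ).image Γ.tail).card < S.card := by
  classical
  obtain ⟨γ₁, γ₂, hne, hdist⟩ := h
  have hv₁ : γ₁.verts.Nonempty := ⟨_, γ₁.tail_mem_verts ⟨0, hl₁⟩⟩
  have hv₂ : γ₂.verts.Nonempty := ⟨_, γ₂.tail_mem_verts ⟨0, hl₂⟩⟩
  obtain ⟨u, hu, v, hv, huv⟩ : ∃ u ∈ γ₁.verts, ∃ v ∈ γ₂.verts, Γ.toSimpleGraph.edist u v = d := by
    have := hv₁.to_subtype
    have := hv₂.to_subtype
    rw [setDist] at hdist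
    simp only [iInf_subtype'] at hdist
    obtain ⟨u, hu⟩ := ENat.exists_eq_iInf fun u : γ₁.verts =>
      ⨅ v : γ₂.verts, Γ.toSimpleGraph.edist (u : V) (v : V)
    obtain ⟨v, hv⟩ := ENat.exists_eq_iInf fun v : γ₂.verts => Γ.toSimpleGraph.edist (u : V) (v : V)
    exact ⟨u, u.2, v, v.2, hv.trans (hu.trans hdist)⟩
  obtain ⟨m, w, h, hmd, hw0, hwm, hinj, hh⟩ := Γ.exists_path huv
  let S₁ : Finset E := Finset.univ.image fun j => (γ₁.edge j).1
  let S₂ : Finset E := Finset.univ.image fun j => (γ₂.edge j).1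
  let P : Finset E := (Finset.range m).image fun i => (h i).1
  have hS₁ : ∀ e, e ∈ S₁ ↔ e ∈ γ₁.edges := by simp [S₁, ClosedPath.edges]
  have hS₂ : ∀ e, e ∈ S₂ ↔ e ∈ γ₂.edges := by simp [S₂, ClosedPath.edges]
  have hSub₁ : γ₁.edges ⊆ (S₁ ∪ S₂ ∪ P : Finset E) := fun e he => by simp [hS₁, he]
  have hSub₂ : γ₂.edges ⊆ (S₁ ∪ S₂ ∪ P : Finset E) := fun e he => by simp [hS₂, he]
  have hP : ∀ i < m, (h i).1 ∈ S₁ ∪ S₂ ∪ P := fun i hi =>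
    Finset.mem_union_right _ (Finset.mem_image_of_mem _ (Finset.mem_range.2 hi))
  refine ⟨S₁ ∪ S₂ ∪ P, ?_, ?_⟩
  · have h1 : S₁.card ≤ l₁ := Finset.card_image_le.trans (by simp)
    have h2 : S₂.card ≤ l₂ := Finset.card_image_le.trans (by simp)
    have h3 : P.card ≤ m := Finset.card_image_le.trans (by simp)
    have h4 := Finset.card_union_le (S₁ ∪ S₂) P
    have h5 := Finset.card_union_le S₁ S₂
    omega
  by_contra! hcard
  -- at an inner vertex of the connecting path, its two neighbours on the path are different
  have hdegP : ∀ i ≤ m, ∃ x y : E × Bool, x ≠ y ∧ (Γ.tail x = w i ∧ x.1 ∈ S₁ ∪ S₂ ∪ P) ∧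
      (Γ.tail y = w i ∧ y.1 ∈ S₁ ∪ S₂ ∪ P) := by
    intro i hi
    rcases Nat.eq_zero_or_pos i with rfl | h0
    · obtain ⟨x, y, hxy, hx, hy⟩ := γ₁.exists_ne_of_mem_verts hu
      exact ⟨x, y, hxy, ⟨hx.1.trans hw0.symm, hSub₁ hx.2⟩, hy.1.trans hw0.symm, hSub₁ hy.2⟩
    rcases eq_or_lt_of_le hi with rfl | him
    · obtain ⟨x, y, hxy, hx, hy⟩ := γ₂.exists_ne_of_mem_verts hv
      exact ⟨x, y, hxy, ⟨hx.1.trans hwm.symm, hSub₂ hx.2⟩, hy.1.trans hwm.symm, hSub₂ hy.2⟩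
    obtain ⟨i, rfl⟩ : ∃ j, i = j + 1 := ⟨i - 1, by omega⟩
    refine ⟨h (i + 1), rev (h i), fun heq => ?_, ⟨(hh _ him).1, hP _ him⟩,
      (hh i (by omega)).2, hP i (by omega)⟩
    have h2 := (hh _ him).2
    rw [heq, head, rev_rev, (hh i (by omega)).1] at h2
    have := hinj _ (by omega) _ (by omega) h2
    omega
  have hdeg2 := Γ.eq_or_eq_or_eq_of_card_le (S₁ ∪ S₂ ∪ P) (fun a ha => by
    obtain ⟨x, hx, rfl⟩ := Finset.mem_image.1 ha
    rcases Finset.mem_union.1 (Finset.mem_product.1 hx).1 with hx | hx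
    · rcases Finset.mem_union.1 hx with hx | hx
      · obtain ⟨y, z, hyz, hy, hz⟩ := γ₁.exists_ne_of_mem_verts
          (γ₁.tail_mem_verts_of_mem_edges ((hS₁ _).1 hx))
        exact ⟨y, z, hyz, ⟨hy.1, hSub₁ hy.2⟩, hz.1, hSub₁ hz.2⟩
      · obtain ⟨y, z, hyz, hy, hz⟩ := γ₂.exists_ne_of_mem_verts
          (γ₂.tail_mem_verts_of_mem_edges ((hS₂ _).1 hx))
        exact ⟨y, z, hyz, ⟨hy.1, hSub₂ hy.2⟩, hz.1, hSub₂ hz.2⟩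
    · obtain ⟨i, hi, hix⟩ := Finset.mem_image.1 hx
      have hi := Finset.mem_range.1 hi
      rcases eq_or_eq_rev hix.symm with hx | hx
      · rw [hx, (hh i hi).1]
        exact hdegP i hi.le
      · rw [hx]
        change ∃ x y, x ≠ y ∧ (Γ.tail x = Γ.head (h i) ∧ _) ∧ (Γ.tail y = Γ.head (h i) ∧ _)
        rw [(hh i hi).2]
        exact hdegP (i + 1) hi) hcard
  -- with all degrees equal to two, the connecting path cannot leave `γ₁`
  have hw : ∀ i ≤ m, w i ∈ γ₁.verts := by
    intro i
    induction i with
    | zero => exact fun _ => hw0 ▸ hu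
    | succ i ih =>
      intro hi
      have hmem := γ₁.mem_edges_of_tail_mem_verts hSub₁ hdeg2 (hP i hi)
        ((hh i hi).1 ▸ ih (by omega))
      rw [← (hh i hi).2]
      exact γ₁.tail_mem_verts_of_mem_edges (x := rev (h i)) hmem
  have hv' : v ∈ γ₁.verts := hwm ▸ hw m le_rfl
  obtain ⟨k, c, hk, hc, hcγ⟩ := γ₁.exists_isSimple hl₁
  have hcv : Γ.tail (c.edge ⟨0, hk⟩) ∈ γ₁.verts :=
    γ₁.tail_mem_verts_of_mem_edges (hcγ ⟨_, rfl⟩)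
  have h1c : γ₁.edges = c.edges := (γ₁.edges_subset_edges c hSub₁ (hcγ.trans hSub₁) hdeg2 hcv
    (c.tail_mem_verts _)).antisymm hcγ
  refine hne ⟨k, c, hc, h1c, ?_⟩
  rw [← h1c]
  exact (γ₂.edges_subset_edges γ₁ hSub₂ hSub₁ hdeg2 hv hv').antisymm
    (γ₁.edges_subset_edges γ₂ hSub₁ hSub₂ hdeg2 hv' hv)

end CubicGraph

open scoped Nat

/-! ### Counting drawings -/

/-- A bijection is determined by its restriction to `A` and, once one bijection with that
restriction is chosen, by a permutation of the complement of `A`. -/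
theorem card_equiv_mapsTo_le {α β : Type*} [Fintype α] [Fintype β] [DecidableEq α] [DecidableEq β]
    (A : Finset α) (B : Finset β) :
    (Finset.univ.filter fun e : α ≃ β => ∀ a ∈ A, e a ∈ B).card ≤
      B.card ^ A.card * (Fintype.card α - A.card)! := by
  classical
  let r : (α ≃ β) → (A → β) := fun e a => e a
  have hmaps : ∀ e ∈ Finset.univ.filter (fun e : α ≃ β => ∀ a ∈ A, e a ∈ B),
      r e ∈ Fintype.piFinset fun _ : A => B := by
    intro e he
    rw [Fintype.mem_piFinset]
    exact fun a => (Finset.mem_filter.1 he).2 a a.2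
  refine (Finset.card_le_mul_card_image_of_maps_to hmaps _ fun f _ => ?_).trans
    (b := (Fintype.card α - A.card)! * (Fintype.piFinset fun _ : A => B).card) ?_
  · rcases Finset.eq_empty_or_nonempty ({e ∈ Finset.univ.filter
      (fun e : α ≃ β => ∀ a ∈ A, e a ∈ B) | r e = f}) with h0 | ⟨e₀, he₀⟩
    · rw [h0]
      simp
    have he₀ := (Finset.mem_filter.1 he₀).2
    have hcard : Fintype.card {g : Equiv.Perm α // ∀ a, ¬ a ∉ A → g a = a} =
        (Fintype.card α - A.card)! := by
      rw [← Fintype.card_congr (Equiv.Perm.subtypeEquivSubtypePerm fun a => a ∉ A),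
        Fintype.card_perm, Fintype.card_subtype_compl, Fintype.card_coe]
    rw [← hcard, Fintype.card_subtype]
    refine Finset.card_le_card_of_injOn (fun e => e.trans e₀.symm) (fun e he => ?_) ?_
    · have he := (Finset.mem_filter.1 he).2
      simp only [Finset.coe_filter, Finset.mem_univ, true_and, Set.mem_ofPred_eq, not_not]
      intro a ha
      have : e a = e₀ a := congrFun (he.trans he₀.symm) ⟨a, ha⟩
      simp [this]
    · intro e _ e' _ h
      ext a
      simpa using Equiv.congr_fun h a
  · rw [Fintype.card_piFinset, Finset.prod_const, Finset.card_univ, Fintype.card_coe, mul_comm]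

namespace Drawing

variable {n : ℕ}

theorem card (n : ℕ) : Fintype.card (Drawing n) = (6 * n)! := by
  rw [Fintype.card_equiv (Classical.arbitrary (Drawing n))]
  congr 1
  simp
  ring

/-- The drawings in which some `k + 1` edges have all their ends among some `k` vertices. -/
def dense (n k : ℕ) : Finset (Drawing n) :=
  (Finset.univ.powersetCard (k + 1) ×ˢ Finset.univ.powersetCard k).biUnion
    fun p : Finset (Fin (3 * n)) × Finset (Fin (2 * n)) =>
      Finset.univ.filter fun σ : Drawing n =>
        ∀ x ∈ p.1 ×ˢ (Finset.univ : Finset Bool), σ x ∈ p.2 ×ˢ (Finset.univ : Finset (Fin 3))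

/-- The first moment bound: dense drawings have probability `O(1 / n)`. -/
theorem card_dense_mul_le {n k : ℕ} (hk : 2 * k + 2 ≤ 3 * n) :
    (dense n k).card * (3 * n) ≤ (3 * k) ^ (2 * k + 2) * Fintype.card (Drawing n) := by
  have hfac : (6 * n - (2 * k + 2))! * (6 * n).descFactorial (2 * k + 2) = (6 * n)! :=
    Nat.factorial_mul_descFactorial (by omega)
  have hdesc : (3 * n) ^ (2 * k + 2) ≤ (6 * n).descFactorial (2 * k + 2) :=
    (Nat.pow_le_pow_left (by omega) _).trans (Nat.pow_sub_le_descFactorial _ _)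
  have hcount : (dense n k).card ≤
      ((3 * n) ^ (k + 1) * (3 * n) ^ k) * ((3 * k) ^ (2 * k + 2) * (6 * n - (2 * k + 2))!) := by
    refine (Finset.card_biUnion_le_card_mul _ _
      ((3 * k) ^ (2 * k + 2) * (6 * n - (2 * k + 2))!) ?_).trans ?_
    · rintro ⟨S, T⟩ hST
      simp only [Finset.mem_product, Finset.mem_powersetCard_univ] at hST
      refine (card_equiv_mapsTo_le _ _).trans (le_of_eq ?_)
      simp only [Finset.card_product, hST.1, hST.2, Finset.card_univ, Fintype.card_prod,
        Fintype.card_fin, Fintype.card_bool]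
      rw [mul_comm k 3, show (k + 1) * 2 = 2 * k + 2 by ring, show 3 * n * 2 = 6 * n by ring]
    · refine Nat.mul_le_mul_right _ ?_
      rw [Finset.card_product, Finset.card_powersetCard, Finset.card_powersetCard,
        Finset.card_univ, Finset.card_univ, Fintype.card_fin, Fintype.card_fin]
      exact Nat.mul_le_mul (Nat.choose_le_pow _ _)
        ((Nat.choose_le_pow _ _).trans (Nat.pow_le_pow_left (by omega) _))
  calc (dense n k).card * (3 * n)
      ≤ ((3 * n) ^ (k + 1) * (3 * n) ^ k) *
        ((3 * k) ^ (2 * k + 2) * (6 * n - (2 * k + 2))!) * (3 * n) := Nat.mul_le_mul_right _ hcount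
    _ = (3 * k) ^ (2 * k + 2) * ((6 * n - (2 * k + 2))! * (3 * n) ^ (2 * k + 2)) := by ring
    _ ≤ (3 * k) ^ (2 * k + 2) * ((6 * n - (2 * k + 2))! * (6 * n).descFactorial (2 * k + 2)) := by
        gcongr
    _ = (3 * k) ^ (2 * k + 2) * Fintype.card (Drawing n) := by rw [hfac, card]

theorem exists_mem_dense {σ : Drawing n} {S : Finset (Fin (3 * n))}
    (h : ((S ×ˢ Finset.univ).image σ.graph.tail).card < S.card) :
    ∃ k < S.card, σ ∈ dense n k := by
  obtain ⟨S', hS', hcard⟩ := Finset.exists_subset_card_eq (Nat.succ_le_of_lt h)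
  refine ⟨_, h, Finset.mem_biUnion.2 ⟨(S', (S ×ˢ Finset.univ).image σ.graph.tail), ?_, ?_⟩⟩
  · simpa using hcard
  · refine Finset.mem_filter.2 ⟨Finset.mem_univ _, fun x hx => ?_⟩
    refine Finset.mem_product.2 ⟨Finset.mem_image.2 ⟨x, ?_, rfl⟩, Finset.mem_univ _⟩
    simpa using hS' (Finset.mem_product.1 hx).1

end Drawing

theorem tendsto_toOuterMeasure_hasClosedPathsAtDist (l₁ l₂ d : ℕ) (hl₁ : 0 < l₁) (hl₂ : 0 < l₂) :
    Tendsto (fun n : ℕ => (PMF.uniformOfFintype (Drawing n)).toOuterMeasure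
      {σ | σ.graph.HasClosedPathsAtDist l₁ l₂ d}) atTop (𝓝 0) := by
  classical
  let L := l₁ + l₂ + d
  let C : ℕ := ∑ k ∈ Finset.range L, (3 * k) ^ (2 * k + 2)
  have hC : Tendsto (fun n : ℕ => (C : ENNReal) / (n : ENNReal)) atTop (𝓝 0) := by
    simpa [div_eq_mul_inv] using ENNReal.Tendsto.const_mul (a := (C : ENNReal))
      ENNReal.tendsto_inv_nat_nhds_zero (Or.inr (ENNReal.natCast_ne_top C))
  refine tendsto_of_tendsto_of_tendsto_of_le_of_le' tendsto_const_nhds hC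
    (Eventually.of_forall fun _ => bot_le) ?_
  filter_upwards [eventually_ge_atTop (2 * L + 1)] with n hn
  have hsub : (Finset.univ.filter fun σ : Drawing n => σ.graph.HasClosedPathsAtDist l₁ l₂ d) ⊆
      (Finset.range L).biUnion (Drawing.dense n) := by
    intro σ hσ
    obtain ⟨S, hS, hlt⟩ := (Finset.mem_filter.1 hσ).2.exists_card_lt hl₁ hl₂
    obtain ⟨k, hk, hmem⟩ := Drawing.exists_mem_dense hlt
    exact Finset.mem_biUnion.2 ⟨k, Finset.mem_range.2 (hk.trans_le hS), hmem⟩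
  have hcard : (Finset.univ.filter fun σ : Drawing n =>
      σ.graph.HasClosedPathsAtDist l₁ l₂ d).card * n ≤ C * Fintype.card (Drawing n) := by
    calc _ ≤ (∑ k ∈ Finset.range L, (Drawing.dense n k).card) * (3 * n) :=
          Nat.mul_le_mul ((Finset.card_le_card hsub).trans Finset.card_biUnion_le) (by omega)
      _ = ∑ k ∈ Finset.range L, (Drawing.dense n k).card * (3 * n) := Finset.sum_mul _ _ _
      _ ≤ ∑ k ∈ Finset.range L, (3 * k) ^ (2 * k + 2) * Fintype.card (Drawing n) := by
          refine Finset.sum_le_sum fun k hk => Drawing.card_dense_mul_le ?_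
          have := Finset.mem_range.1 hk
          omega
      _ = C * Fintype.card (Drawing n) := (Finset.sum_mul _ _ _).symm
  rw [PMF.toOuterMeasure_uniformOfFintype_apply]
  refine ENNReal.div_le_of_le_mul ?_
  rw [← ENNReal.mul_div_right_comm, ENNReal.le_div_iff_mul_le
    (Or.inl (by simp; omega)) (Or.inl (ENNReal.natCast_ne_top n))]
  have : Fintype.card {σ : Drawing n | σ.graph.HasClosedPathsAtDist l₁ l₂ d} =
      (Finset.univ.filter fun σ : Drawing n => σ.graph.HasClosedPathsAtDist l₁ l₂ d).card :=
    Fintype.card_subtype _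
  rw [this]
  exact_mod_cast hcard

theorem lemma3p5 (l₁ l₂ d : ℕ) (hl₁ : 0 < l₁) (hl₂ : 0 < l₂) :
    Tendsto (fun n : ℕ => (cubicPMF n).prob {Γ | Γ.HasClosedPathsAtDist l₁ l₂ d})
      atTop (𝓝 0) ∧
    Tendsto (fun n : ℕ => (orientedCubicPMF n).prob {P | P.1.HasClosedPathsAtDist l₁ l₂ d})
      atTop (𝓝 0) := by
  have h := tendsto_toOuterMeasure_hasClosedPathsAtDist l₁ l₂ d hl₁ hl₂
  constructor
  · simp only [PMF.prob, cubicPMF, PMF.toOuterMeasure_map_apply]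
    exact h
  · simp only [PMF.prob, orientedCubicPMF, PMF.toOuterMeasure_map_apply]
    exact h
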